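/- Let $s\in(-1,0)$. A function $g:\mathbb{R}\to\mathbb{R}_+=[0,\infty)$ is called $s$-concave if for all $\lambda\in[0,1]$ and all $x,y\in\mathbb{R}$ with $g(x)g(y)>0$ one has $$g((1-\lambda)x+\lambda y)\ge\big((1-\lambda)g(x)^s+\lambda g(y)^s\big)^{1/s}.$$ The $s$-polar of $g$ is $$\mathcal{L}_s g(y)=\inf_{x\in\mathbb{R},\,g(x)>0}\frac{(1-sxy)_+^{1/s}}{g(x)}\qquad(y\in\mathbb{R}),$$ where $t_+=\max(t,0)$ and $0^{1/s}=+\infty$. Let $g:\mathbb{R}\to\mathbb{R}_+$ be an even $s$-concave function with $0<\int_{\mathbb{R}}g<+\infty$. Then $$\int_{\mathbb{R}}g(x)\,dx\int_{\mathbb{R}}\mathcal{L}_s g(y)\,dy\ \ge\ \frac{4}{1+s}.$$ Equality holds if and only if there are $c>0$ and $a>0$ such that $g(x)=c\,\mathbf{1}_{[-a,a]}(x)$ for all $x\in\mathbb{R}\setminus\{-a,a\}$. In particular, if $g$ is moreover upper semicontinuous, then equality holds if and only if $g=c\,\mathbf{1}_{[-a,a]}$ for some $c>0$ and $a>0$.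 -/

import Mathlib

open scoped NNReal ENNReal

/-- `g : ℝ → ℝ₊` is `s`-concave: for all `x, y` with `g x * g y > 0` and all `t ∈ [0,1]`,
`g ((1-t)x + ty)` is at least the `s`-mean of `g x` and `g y` with weights `1-t` and `t`
(the geometric mean if `s = 0`). -/
def IsSConcave (s : ℝ) (g : ℝ → ℝ≥0) : Prop :=
  ∀ x y t : ℝ, 0 ≤ t → t ≤ 1 → 0 < g x * g y →
    (if s = 0 then (g x : ℝ) ^ (1 - t) * (g y : ℝ) ^ t
      else ((1 - t) * (g x : ℝ) ^ s + t * (g y : ℝ) ^ s) ^ (1 / s))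
      ≤ (g ((1 - t) * x + t * y) : ℝ)

/-- The `s`-polar `L_s g (y) = inf_{x : g x > 0} (1 - s x y)₊ ^ (1/s) / g x`
(with `exp (-x y)` as numerator if `s = 0`), with values in `[0, ∞]`.
`ENNReal.ofReal` is the positive part, and for `s < 0` the power `0 ^ (1/s)` is `∞`,
as it has to be. -/
noncomputable def sPolar (s : ℝ) (g : ℝ → ℝ≥0) (y : ℝ) : ℝ≥0∞ :=
  ⨅ (x : ℝ) (_ : 0 < g x),
    (if s = 0 then ENNReal.ofReal (Real.exp (-(x * y)))
      else ENNReal.ofReal (1 - s * (x * y)) ^ (1 / s)) / (g x : ℝ≥0∞)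

/-!
Put `f = (g / g 0) ^ (-s)` on `[0, ∞)` and `p = -1 / s > 1`. Then `1 / f` is convex, the `s`-polar
of `g` becomes the polar `f° v = inf_u 1 / ((1 + u v) f u)`, which has the same properties as `f`,
and the inequality reads `P p := (p - 1) ∫ f ^ p ∫ f° ^ p ≥ 1`.

Fix `u`. Substituting `x = (1 - t) w + t u` in `∫_{t u}^∞ f x ^ p` and using convexity of `1 / f`
together with Bernoulli's inequality gives, at first order in `t → 0`,
`f u * (u + (p - 1) ∫ f ^ p) ≤ p ∫ f ^ (p + 1)`.
This bounds `1 / f°` at `v = 1 / ((p - 1) ∫ f ^ p)`; with the same inequality for `f°` at `v` it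
yields `1 + (p - 1) P p ≤ p P (p + 1)`, so the result for `p` implies the result for `p + 1`,
together with the case of equality.

For `1 < p ≤ 2`, letting the exponent tend to `1` gives `u * f u ≤ ∫ f ^ p`. Hence
`1 / f° v ≤ 1 + v ∫ f ^ p`, and integrating the `-p`-th power gives `P p ≥ 1`. Equality forces
`1 / f° v = 1 + v ∫ f ^ p` for some `v > 0`, so that `f = 1` on `[0, ∫ f ^ p)`, which leaves no mass
beyond.
-/

open MeasureTheory Set Filter Topology

theorem one_add_mul_rpow_sub_le_inv_rpow {a X q : ℝ} (ha : 0 < a) (hX : 0 < X) (hq : 0 ≤ q) :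
    (1 + q) * a ^ q - q * X * a ^ (q + 1) ≤ X⁻¹ ^ q := by
  have haX : 0 < a * X := mul_pos ha hX
  have bernoulli : 1 - q * (a * X - 1) ≤ (a * X)⁻¹ ^ q := calc
    1 - q * (a * X - 1) ≤ -(Real.log (a * X) * q) + 1 := by
      nlinarith [Real.log_le_sub_one_of_pos haX]
    _ ≤ Real.exp (-(Real.log (a * X) * q)) := Real.add_one_le_exp _
    _ = (a * X)⁻¹ ^ q := by
      rw [Real.inv_rpow haX.le, Real.rpow_def_of_pos haX, Real.exp_neg]
  calc (1 + q) * a ^ q - q * X * a ^ (q + 1) = a ^ q * (1 - q * (a * X - 1)) := by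
        rw [Real.rpow_add_one ha.ne']; ring
    _ ≤ a ^ q * (a * X)⁻¹ ^ q := by gcongr
    _ = X⁻¹ ^ q := by
        rw [← Real.mul_rpow ha.le (by positivity), mul_inv, mul_inv_cancel_left₀ ha.ne']

section HalfLine

variable {F : ℝ → ℝ} {k c : ℝ}

theorem integral_Ioi_comp_mul_add (F : ℝ → ℝ) (hk : 0 < k) (c : ℝ) :
    ∫ x in Ioi 0, F (k * x + c) = k⁻¹ * ∫ x in Ioi c, F x := by
  have hshift := (measurePreserving_add_right volume c).setIntegral_preimage_emb
    (measurableEmbedding_addRight c) F (Ioi c)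
  rw [preimage_add_const_Ioi, sub_self] at hshift
  rw [integral_comp_mul_left_Ioi (fun x => F (x + c)) 0 hk, mul_zero, hshift, smul_eq_mul]

theorem integrableOn_Ioi_comp_mul_add (hk : 0 < k) (hF : IntegrableOn F (Ioi c)) :
    IntegrableOn (fun x => F (k * x + c)) (Ioi 0) := by
  have hshift := (measurePreserving_add_right volume c).integrableOn_comp_preimage
    (f := F) (s := Ioi c) (measurableEmbedding_addRight c)
  rw [preimage_add_const_Ioi, sub_self] at hshift
  rw [integrableOn_Ioi_comp_mul_left_iff (fun x => F (x + c)) 0 hk, mul_zero]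
  exact hshift.2 hF

theorem lintegral_ofReal_comp_mul_abs (hk : 0 < k) (hF : IntegrableOn F (Ioi 0))
    (hF0 : ∀ x, 0 ≤ x → 0 ≤ F x) :
    ∫⁻ x, ENNReal.ofReal (F (k * |x|)) = ENNReal.ofReal (2 * (k⁻¹ * ∫ x in Ioi 0, F x)) := by
  have hpos : IntegrableOn (fun x => F (k * |x|)) (Ioi 0) := by
    rw [integrableOn_congr_fun (g := fun x => F (k * x))
      (fun x hx => by simp only [abs_of_pos (mem_Ioi.1 hx)]) measurableSet_Ioi]
    simpa using integrableOn_Ioi_comp_mul_add (c := 0) hk hF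
  have hneg : IntegrableOn (fun x => F (k * |x|)) (Iic 0) := by
    rw [integrableOn_Iic_iff_integrableOn_Iio]
    simpa using hpos.comp_neg
  have hint : Integrable fun x => F (k * |x|) := by
    rw [← integrableOn_univ, ← Iic_union_Ioi (a := (0 : ℝ))]
    exact hneg.union hpos
  have heq := integral_Ioi_comp_mul_add F hk 0
  simp only [add_zero] at heq
  rw [← ofReal_integral_eq_lintegral_ofReal hint
    (Eventually.of_forall fun x => hF0 _ (by positivity)),
    integral_comp_abs (f := fun x => F (k * x)), heq]

theorem setIntegral_lt_setIntegral_of_lt {α : Type*} [MeasurableSpace α] {μ : Measure α}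
    {s : Set α} {F H : α → ℝ} (hs : MeasurableSet s) (hμ : μ s ≠ 0) (hF : IntegrableOn F s μ)
    (hH : IntegrableOn H s μ) (hlt : ∀ x ∈ s, F x < H x) :
    ∫ x in s, F x ∂μ < ∫ x in s, H x ∂μ := by
  have hsupp : s ⊆ Function.support fun x => H x - F x := fun x hx => (sub_pos.2 (hlt x hx)).ne'
  have hpos : 0 < ∫ x in s, (H x - F x) ∂μ := by
    rw [setIntegral_pos_iff_support_of_nonneg_ae
      ((ae_restrict_iff' hs).2 (.of_forall fun x hx => (sub_pos.2 (hlt x hx)).le)) (hH.sub hF),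
      inter_eq_right.2 hsupp]
    exact pos_iff_ne_zero.2 hμ
  rwa [integral_sub hH hF, sub_pos] at hpos

theorem integrableOn_Ioi_mul_add_one_rpow_neg {p : ℝ} (hp : 1 < p) (hk : 0 < k) :
    IntegrableOn (fun x : ℝ => (k * x + 1) ^ (-p)) (Ioi 0) :=
  integrableOn_Ioi_comp_mul_add (F := fun x => x ^ (-p)) hk
    (integrableOn_Ioi_rpow_of_lt (by linarith) one_pos)

theorem integral_Ioi_mul_add_one_rpow_neg {p : ℝ} (hp : 1 < p) (hk : 0 < k) :
    ∫ x in Ioi (0 : ℝ), (k * x + 1) ^ (-p) = (k * (p - 1))⁻¹ := by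
  rw [integral_Ioi_comp_mul_add (fun x => x ^ (-p)) hk,
    integral_Ioi_rpow_of_lt (by linarith) one_pos, Real.one_rpow, mul_inv, ← one_div (p - 1),
    ← neg_div_neg_eq 1 (p - 1)]
  congr 3
  ring

end HalfLine

/-- The class of functions on `[0, ∞)` to which even `s`-concave functions reduce: normalized at
the origin, with convex reciprocal where positive, neither concentrated at the origin nor constant.
Values at negative arguments are irrelevant. -/
structure IsProfile (f : ℝ → ℝ) : Prop where
  nonneg : ∀ {x}, 0 ≤ x → 0 ≤ f x
  map_zero : f 0 = 1
  le_one : ∀ {x}, 0 ≤ x → f x ≤ 1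
  convexOn_inv : ConvexOn ℝ {x | 0 ≤ x ∧ 0 < f x} fun x => (f x)⁻¹
  exists_pos : ∃ x > 0, 0 < f x
  exists_lt_one : ∃ x > 0, f x < 1

/-- The `p`-th power moment `∫₀^∞ f ^ p`. -/
noncomputable def powIntegral (f : ℝ → ℝ) (p : ℝ) : ℝ := ∫ x in Ioi 0, f x ^ p

namespace IsProfile

variable {f : ℝ → ℝ} {p q t u v w x y : ℝ}

theorem apply_interp_pos (hf : IsProfile f) (hx : 0 ≤ x) (hy : 0 ≤ y) (hfx : 0 < f x)
    (hfy : 0 < f y) (ht : 0 ≤ t) (ht1 : t ≤ 1) : 0 < f ((1 - t) * x + t * y) :=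
  (hf.convexOn_inv.1 ⟨hx, hfx⟩ ⟨hy, hfy⟩ (sub_nonneg.2 ht1) ht (by ring)).2

theorem inv_apply_interp_le (hf : IsProfile f) (hx : 0 ≤ x) (hy : 0 ≤ y) (hfx : 0 < f x)
    (hfy : 0 < f y) (ht : 0 ≤ t) (ht1 : t ≤ 1) :
    (f ((1 - t) * x + t * y))⁻¹ ≤ (1 - t) * (f x)⁻¹ + t * (f y)⁻¹ :=
  hf.convexOn_inv.2 ⟨hx, hfx⟩ ⟨hy, hfy⟩ (sub_nonneg.2 ht1) ht (by ring)

theorem apply_mul_pos (hf : IsProfile f) (hu : 0 ≤ u) (hfu : 0 < f u) (ht : 0 ≤ t)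
    (ht1 : t ≤ 1) : 0 < f (t * u) := by
  simpa using hf.apply_interp_pos le_rfl hu (hf.map_zero ▸ one_pos) hfu ht ht1

theorem inv_apply_mul_le (hf : IsProfile f) (hu : 0 ≤ u) (hfu : 0 < f u) (ht : 0 ≤ t)
    (ht1 : t ≤ 1) : (f (t * u))⁻¹ ≤ 1 - t + t * (f u)⁻¹ := by
  simpa [hf.map_zero] using
    hf.inv_apply_interp_le le_rfl hu (hf.map_zero ▸ one_pos) hfu ht ht1

theorem antitoneOn (hf : IsProfile f) : AntitoneOn f (Ici 0) := by
  intro w hw u hu hwu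
  rcases (hf.nonneg hu).eq_or_lt with hfu | hfu
  · exact hfu ▸ hf.nonneg hw
  rcases (mem_Ici.1 hu).eq_or_lt with rfl | hu0
  · rw [le_antisymm hwu hw]
  have ht : 0 ≤ w / u := div_nonneg hw hu
  have ht1 : w / u ≤ 1 := div_le_one_of_le₀ hwu hu
  have hfw := hf.apply_mul_pos hu hfu ht ht1
  have hinv := hf.inv_apply_mul_le hu hfu ht ht1
  rw [div_mul_cancel₀ w hu0.ne'] at hfw hinv
  have hone : 1 ≤ (f u)⁻¹ := (one_le_inv₀ hfu).2 (hf.le_one hu)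
  exact (inv_le_inv₀ hfw hfu).1 (by nlinarith)

theorem antitoneOn_rpow (hf : IsProfile f) (hp : 0 ≤ p) : AntitoneOn (fun x => f x ^ p) (Ici 0) :=
  fun _ hx _ hy hxy => Real.rpow_le_rpow (hf.nonneg hy) (hf.antitoneOn hx hy hxy) hp

theorem exists_mul_apply_le (hf : IsProfile f) : ∃ C, ∀ x, 0 ≤ x → x * f x ≤ C := by
  obtain ⟨b, hb, hfb⟩ := hf.exists_lt_one
  refine ⟨b / (1 - f b), fun x hx => (le_div_iff₀ (sub_pos.2 hfb)).2 ?_⟩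
  have hfb0 := hf.nonneg hb.le
  rcases le_or_gt x b with hxb | hbx
  · calc x * f x * (1 - f b) ≤ x * f x * 1 :=
          mul_le_mul_of_nonneg_left (by linarith) (mul_nonneg hx (hf.nonneg hx))
      _ = x * f x := mul_one _
      _ ≤ x := mul_le_of_le_one_right hx (hf.le_one hx)
      _ ≤ b := hxb
  rcases (hf.nonneg hx).eq_or_lt with hfx | hfx
  · simpa [← hfx] using hb.le
  have hx0 : 0 < x := hb.trans hbx
  have ht1 : b / x ≤ 1 := div_le_one_of_le₀ hbx.le hx
  have hpos := hf.apply_mul_pos hx hfx (by positivity) ht1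
  have hinv := hf.inv_apply_mul_le hx hfx (by positivity) ht1
  rw [div_mul_cancel₀ b hx0.ne'] at hpos hinv
  have hcleared : x * f x ≤ (x - b) * f x * f b + b * f b := calc
    x * f x = (f b)⁻¹ * (x * f x * f b) := by field_simp
    _ ≤ (1 - b / x + b / x * (f x)⁻¹) * (x * f x * f b) := by gcongr
    _ = _ := by field_simp
  nlinarith [mul_nonneg hb.le (mul_nonneg hfx.le hfb0)]

theorem integrableOn_rpow (hf : IsProfile f) (hp : 1 < p) :
    IntegrableOn (fun x => f x ^ p) (Ioi 0) := by
  obtain ⟨C, hC⟩ := hf.exists_mul_apply_le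
  have hC0 : 0 ≤ C := by simpa using hC 0 le_rfl
  refine Integrable.mono' ((integrableOn_Ioi_mul_add_one_rpow_neg hp one_pos).const_mul
    ((C + 1) ^ p)) ?_ ((ae_restrict_iff' measurableSet_Ioi).2 (.of_forall fun x hx => ?_))
  · exact (aemeasurable_restrict_of_antitoneOn measurableSet_Ioi
      ((hf.antitoneOn_rpow (by linarith)).mono Ioi_subset_Ici_self)).aestronglyMeasurable
  have hx0 : 0 ≤ x := (mem_Ioi.1 hx).le
  have hx1 : 0 < 1 * x + 1 := by linarith
  have hfx := hf.nonneg hx0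
  have hdecay : f x ≤ (C + 1) / (1 * x + 1) := by
    rw [le_div_iff₀ hx1]
    linarith [hC x hx0, hf.le_one hx0]
  rw [Real.norm_of_nonneg (Real.rpow_nonneg hfx p), Real.rpow_neg hx1.le, ← div_eq_mul_inv,
    ← Real.div_rpow (by linarith) hx1.le]
  exact Real.rpow_le_rpow hfx hdecay (by linarith)

theorem integral_Ioi_rpow_nonneg (hf : IsProfile f) (p : ℝ) (hu : 0 ≤ u) :
    0 ≤ ∫ x in Ioi u, f x ^ p :=
  setIntegral_nonneg measurableSet_Ioi fun _ hx =>
    Real.rpow_nonneg (hf.nonneg (hu.trans (mem_Ioi.1 hx).le)) p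

theorem powIntegral_nonneg (hf : IsProfile f) (p : ℝ) : 0 ≤ powIntegral f p :=
  hf.integral_Ioi_rpow_nonneg p le_rfl

theorem integral_Ioc_add_integral_Ioi (hf : IsProfile f) (hp : 1 < p) (hu : 0 ≤ u) (huv : u ≤ v) :
    (∫ x in Ioc u v, f x ^ p) + ∫ x in Ioi v, f x ^ p = ∫ x in Ioi u, f x ^ p := by
  have hint := (hf.integrableOn_rpow hp).mono_set (Ioi_subset_Ioi hu)
  rw [← setIntegral_union Ioc_disjoint_Ioi_same measurableSet_Ioi
    (hint.mono_set Ioc_subset_Ioi_self) (hint.mono_set (Ioi_subset_Ioi huv)),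
    Ioc_union_Ioi_eq_Ioi huv]

theorem sub_mul_rpow_le_integral_Ioc (hf : IsProfile f) (hp : 1 < p) (hu : 0 ≤ u) (huv : u ≤ v) :
    (v - u) * f v ^ p ≤ ∫ x in Ioc u v, f x ^ p := by
  have hmono := setIntegral_mono_on (μ := volume) (s := Ioc u v) (f := fun _ => f v ^ p)
    (g := fun x => f x ^ p) (by simp)
    ((hf.integrableOn_rpow hp).mono_set fun x hx => hu.trans_lt hx.1) measurableSet_Ioc
    fun x hx => hf.antitoneOn_rpow (by linarith) (hu.trans hx.1.le) (hu.trans huv) hx.2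
  simpa [huv] using hmono

theorem powIntegral_pos (hf : IsProfile f) (hp : 1 < p) : 0 < powIntegral f p := by
  obtain ⟨x, hx, hfx⟩ := hf.exists_pos
  calc 0 < (x - 0) * f x ^ p := by rw [sub_zero]; positivity
    _ ≤ ∫ y in Ioc 0 x, f y ^ p := hf.sub_mul_rpow_le_integral_Ioc hp le_rfl hx.le
    _ ≤ powIntegral f p := by
      rw [powIntegral, ← hf.integral_Ioc_add_integral_Ioi hp le_rfl hx.le]
      exact le_add_of_nonneg_right (hf.integral_Ioi_rpow_nonneg p hx.le)

theorem rpow_sub_le_apply_interp_rpow (hf : IsProfile f) (hq : 0 < q) (hw : 0 ≤ w) (hu : 0 ≤ u)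
    (hfu : 0 < f u) (ht : 0 ≤ t) (ht1 : t ≤ 1) :
    (1 + q * t) * f w ^ q - q * t * (f u)⁻¹ * f w ^ (q + 1) ≤ f ((1 - t) * w + t * u) ^ q := by
  have hz : 0 ≤ (1 - t) * w + t * u := add_nonneg (mul_nonneg (sub_nonneg.2 ht1) hw) (by positivity)
  rcases (hf.nonneg hw).eq_or_lt with hfw | hfw
  · rw [← hfw, Real.zero_rpow hq.ne', Real.zero_rpow (by linarith), mul_zero, mul_zero, sub_zero]
    exact Real.rpow_nonneg (hf.nonneg hz) q
  have hpos := hf.apply_interp_pos hw hu hfw hfu ht ht1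
  have hinv := hf.inv_apply_interp_le hw hu hfw hfu ht ht1
  calc (1 + q * t) * f w ^ q - q * t * (f u)⁻¹ * f w ^ (q + 1)
      = (1 + q) * f w ^ q - q * ((1 - t) * (f w)⁻¹ + t * (f u)⁻¹) * f w ^ (q + 1) := by
        rw [Real.rpow_add_one hfw.ne']; field_simp; ring
    _ ≤ (1 + q) * f w ^ q - q * (f ((1 - t) * w + t * u))⁻¹ * f w ^ (q + 1) := by gcongr
    _ ≤ (f ((1 - t) * w + t * u))⁻¹⁻¹ ^ q :=
        one_add_mul_rpow_sub_le_inv_rpow hfw (inv_pos.2 hpos) hq.le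
    _ = f ((1 - t) * w + t * u) ^ q := by rw [inv_inv]

theorem powIntegral_sub_le_integral_Ioi (hf : IsProfile f) (hq : 1 < q) (hu : 0 ≤ u)
    (hfu : 0 < f u) (ht : 0 ≤ t) (ht1 : t < 1) :
    (1 - t) * ((1 + q * t) * powIntegral f q - q * t * (f u)⁻¹ * powIntegral f (q + 1)) ≤
      ∫ x in Ioi (t * u), f x ^ q := by
  have h1t : 0 < 1 - t := sub_pos.2 ht1
  have hint := (hf.integrableOn_rpow hq).const_mul (1 + q * t)
  have hint' := (hf.integrableOn_rpow (p := q + 1) (by linarith)).const_mul (q * t * (f u)⁻¹)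
  have hmono := setIntegral_mono_on (hint.sub hint')
    (integrableOn_Ioi_comp_mul_add (F := fun x => f x ^ q) (c := t * u) h1t
      ((hf.integrableOn_rpow hq).mono_set (Ioi_subset_Ioi (by positivity)))) measurableSet_Ioi
    fun w hw => hf.rpow_sub_le_apply_interp_rpow (by linarith) (mem_Ioi.1 hw).le hu hfu ht ht1.le
  simp only [Pi.sub_apply] at hmono
  rwa [integral_sub hint hint', integral_const_mul, integral_const_mul,
    integral_Ioi_comp_mul_add (fun x => f x ^ q) h1t, ← div_eq_inv_mul, le_div_iff₀' h1t] at hmono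

theorem add_powIntegral_sub_le (hf : IsProfile f) (hq : 1 < q) (hu : 0 ≤ u) (hfu : 0 < f u)
    (ht : 0 < t) (ht1 : t < 1) :
    u * (1 + q * t - q * t * (f u)⁻¹) + (q - 1 - q * t) * powIntegral f q ≤
      (1 - t) * q * (f u)⁻¹ * powIntegral f (q + 1) := by
  have htu : 0 ≤ t * u := by positivity
  have htail := hf.powIntegral_sub_le_integral_Ioi hq hu hfu ht.le ht1
  have hhead : t * u * (1 + q * t - q * t * (f u)⁻¹) ≤ ∫ x in Ioc 0 (t * u), f x ^ q := by
    refine le_trans ?_ (hf.sub_mul_rpow_le_integral_Ioc hq le_rfl htu)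
    rw [sub_zero]
    gcongr
    simpa [hf.map_zero] using
      hf.rpow_sub_le_apply_interp_rpow (by linarith) le_rfl hu hfu ht.le ht1.le
  have hsplit : _ = powIntegral f q := hf.integral_Ioc_add_integral_Ioi hq le_rfl htu
  refine le_of_mul_le_mul_left ?_ ht
  linarith

theorem mul_add_powIntegral_le (hf : IsProfile f) (hq : 1 < q) (hu : 0 ≤ u) :
    f u * (u + (q - 1) * powIntegral f q) ≤ q * powIntegral f (q + 1) := by
  rcases (hf.nonneg hu).eq_or_lt with hfu | hfu
  · rw [← hfu, zero_mul]
    exact mul_nonneg (by linarith) (hf.powIntegral_nonneg _)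
  have hlim : u + (q - 1) * powIntegral f q ≤ q * (f u)⁻¹ * powIntegral f (q + 1) := by
    have hleft : Tendsto (fun t => u * (1 + q * t - q * t * (f u)⁻¹) +
        (q - 1 - q * t) * powIntegral f q) (𝓝[>] 0) (𝓝 (u + (q - 1) * powIntegral f q)) :=
      (Continuous.tendsto' (by fun_prop) _ _ (by simp)).mono_left nhdsWithin_le_nhds
    have hright : Tendsto (fun t => (1 - t) * q * (f u)⁻¹ * powIntegral f (q + 1)) (𝓝[>] 0)
        (𝓝 (q * (f u)⁻¹ * powIntegral f (q + 1))) :=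
      (Continuous.tendsto' (by fun_prop) _ _ (by simp)).mono_left nhdsWithin_le_nhds
    refine le_of_tendsto_of_tendsto hleft hright ?_
    filter_upwards [Ioo_mem_nhdsGT one_pos] with t ht
    exact hf.add_powIntegral_sub_le hq hu hfu ht.1 ht.2
  calc f u * (u + (q - 1) * powIntegral f q) ≤ f u * (q * (f u)⁻¹ * powIntegral f (q + 1)) := by
        gcongr
    _ = q * powIntegral f (q + 1) := by field_simp

theorem mul_apply_le_powIntegral (hf : IsProfile f) (hp : 1 < p) (hp2 : p ≤ 2) (hu : 0 ≤ u) :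
    u * f u ≤ powIntegral f p := by
  have hfu := hf.nonneg hu
  have hbound : ∀ q > 1, u * f u ≤ q * powIntegral f p := fun q hq => calc
    u * f u ≤ f u * (u + (q - 1) * powIntegral f q) := by
      rw [mul_comm]
      gcongr
      exact le_add_of_nonneg_right (mul_nonneg (by linarith) (hf.powIntegral_nonneg q))
    _ ≤ q * powIntegral f (q + 1) := hf.mul_add_powIntegral_le hq hu
    _ ≤ q * powIntegral f p := by
      refine mul_le_mul_of_nonneg_left (setIntegral_mono_on (hf.integrableOn_rpow (by linarith))
        (hf.integrableOn_rpow hp) measurableSet_Ioi fun x hx => ?_) (by linarith)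
      have hx0 := (mem_Ioi.1 hx).le
      exact Real.rpow_le_rpow_of_exponent_ge' (hf.nonneg hx0) (hf.le_one hx0) (by linarith)
        (by linarith)
  have hlim : Tendsto (fun q : ℝ => q * powIntegral f p) (𝓝[>] 1) (𝓝 (powIntegral f p)) :=
    (Continuous.tendsto' (by fun_prop) _ _ (by simp)).mono_left nhdsWithin_le_nhds
  exact ge_of_tendsto hlim (eventually_mem_nhdsWithin.mono hbound)

end IsProfile

/-- The supremum whose reciprocal is the polar of a profile. With `f = (g / g 0) ^ (-s)`, the number
`1 + u * v` is the quantity `1 - s * x * y` at `u = x` and `v = -s * y`. -/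
noncomputable def profileGauge (f : ℝ → ℝ) (v : ℝ) : ℝ := ⨆ u : ℝ≥0, (1 + u * v) * f u

theorem profileGauge_le {f : ℝ → ℝ} {v M : ℝ} (h : ∀ u, 0 ≤ u → (1 + u * v) * f u ≤ M) :
    profileGauge f v ≤ M :=
  ciSup_le fun u => h u u.2

/-- The polar of a profile, the counterpart of `sPolar` on `[0, ∞)`. -/
noncomputable def profilePolar (f : ℝ → ℝ) (v : ℝ) : ℝ := (profileGauge f v)⁻¹

/-- The volume product of a profile and its polar, scaled to equal `1` on indicator functions. -/
noncomputable def polarProduct (f : ℝ → ℝ) (p : ℝ) : ℝ :=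
  (p - 1) * (powIntegral f p * powIntegral (profilePolar f) p)

/-- On `[0, ∞)`, `f` is the indicator function of an interval with endpoints `0` and `a`; the value
at `a` is arbitrary. -/
def IsStepAt (a : ℝ) (f : ℝ → ℝ) : Prop :=
  (∀ x, 0 ≤ x → x < a → f x = 1) ∧ ∀ x, a < x → f x = 0

namespace IsProfile

variable {f : ℝ → ℝ} {a p q u v x : ℝ}

theorem bddAbove_range_gauge (hf : IsProfile f) (hv : 0 ≤ v) :
    BddAbove (range fun u : ℝ≥0 => (1 + u * v) * f u) := by
  obtain ⟨C, hC⟩ := hf.exists_mul_apply_le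
  refine ⟨1 + v * C, forall_mem_range.2 fun u => ?_⟩
  calc (1 + u * v) * f u = f u + v * (u * f u) := by ring
    _ ≤ 1 + v * C := add_le_add (hf.le_one u.2) (mul_le_mul_of_nonneg_left (hC u u.2) hv)

theorem le_gauge (hf : IsProfile f) (hu : 0 ≤ u) (hv : 0 ≤ v) :
    (1 + u * v) * f u ≤ profileGauge f v :=
  le_ciSup (hf.bddAbove_range_gauge hv) (⟨u, hu⟩ : ℝ≥0)

theorem one_le_gauge (hf : IsProfile f) (hv : 0 ≤ v) : 1 ≤ profileGauge f v := by
  simpa [hf.map_zero] using hf.le_gauge le_rfl hv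

theorem gauge_pos (hf : IsProfile f) (hv : 0 ≤ v) : 0 < profileGauge f v :=
  one_pos.trans_le (hf.one_le_gauge hv)

theorem convexOn_gauge (hf : IsProfile f) : ConvexOn ℝ (Ici 0) (profileGauge f) := by
  refine ⟨convex_Ici 0, fun v hv w hw a b ha hb hab => profileGauge_le fun u hu => ?_⟩
  simp only [smul_eq_mul]
  calc (1 + u * (a * v + b * w)) * f u
      = a * ((1 + u * v) * f u) + b * ((1 + u * w) * f u) := by
        linear_combination -f u * hab
    _ ≤ a * profileGauge f v + b * profileGauge f w := by
        gcongr
        exacts [hf.le_gauge hu hv, hf.le_gauge hu hw]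

theorem polar (hf : IsProfile f) : IsProfile (profilePolar f) where
  nonneg hv := inv_nonneg.2 (hf.gauge_pos hv).le
  map_zero := by
    refine inv_eq_one.2 (le_antisymm (profileGauge_le fun u hu => ?_) (hf.one_le_gauge le_rfl))
    simpa using hf.le_one hu
  le_one hv := inv_le_one_of_one_le₀ (hf.one_le_gauge hv)
  convexOn_inv := by
    have hset : {v | 0 ≤ v ∧ 0 < profilePolar f v} = Ici 0 :=
      ext fun v => and_iff_left_of_imp fun hv => inv_pos.2 (hf.gauge_pos hv)
    rw [hset]
    simpa only [profilePolar, inv_inv] using hf.convexOn_gauge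
  exists_pos := ⟨1, one_pos, inv_pos.2 (hf.gauge_pos zero_le_one)⟩
  exists_lt_one := by
    obtain ⟨x, hx, hfx⟩ := hf.exists_pos
    have hv : 0 < (x * f x)⁻¹ := by positivity
    refine ⟨_, hv, inv_lt_one_of_one_lt₀ (lt_of_lt_of_le ?_ (hf.le_gauge hx.le hv.le))⟩
    calc 1 < f x + 1 := lt_add_of_pos_left 1 hfx
      _ = (1 + x * (x * f x)⁻¹) * f x := by field_simp

theorem one_add_mul_polarProduct_le (hf : IsProfile f) (hq : 1 < q) :
    1 + (q - 1) * polarProduct f q ≤ q * polarProduct f (q + 1) := by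
  set A := powIntegral f q
  set B := powIntegral f (q + 1)
  set A' := powIntegral (profilePolar f) q
  set B' := powIntegral (profilePolar f) (q + 1)
  have hB' : 0 ≤ B' := hf.polar.powIntegral_nonneg _
  have hD : 0 < (q - 1) * A := mul_pos (by linarith) (hf.powIntegral_pos hq)
  set D := (q - 1) * A with hDdef
  have hgauge : profileGauge f D⁻¹ ≤ q * B / D := profileGauge_le fun u hu => by
    rw [le_div_iff₀ hD]
    calc (1 + u * D⁻¹) * f u * D = f u * (u + D) := by field_simp; ring
      _ ≤ q * B := hf.mul_add_powIntegral_le hq hu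
  have hpolar : D⁻¹ + (q - 1) * A' ≤ profileGauge f D⁻¹ * (q * B') :=
    (inv_mul_le_iff₀ (hf.gauge_pos (inv_pos.2 hD).le)).1
      (hf.polar.mul_add_powIntegral_le hq (inv_pos.2 hD).le)
  calc 1 + (q - 1) * polarProduct f q = D * (D⁻¹ + (q - 1) * A') := by
        rw [mul_add, mul_inv_cancel₀ hD.ne', polarProduct, hDdef]; ring
    _ ≤ D * (q * B / D * (q * B')) := by
        gcongr
        exact hpolar.trans (mul_le_mul_of_nonneg_right hgauge (by positivity))
    _ = q * polarProduct f (q + 1) := by rw [polarProduct]; field_simp; ring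

theorem gauge_le_mul_powIntegral_add_one (hf : IsProfile f) (hp : 1 < p) (hp2 : p ≤ 2)
    (hv : 0 ≤ v) : profileGauge f v ≤ powIntegral f p * v + 1 :=
  profileGauge_le fun u hu => by
    nlinarith [hf.le_one hu, mul_le_mul_of_nonneg_left (hf.mul_apply_le_powIntegral hp hp2 hu) hv]

theorem polar_rpow (hf : IsProfile f) (p : ℝ) (hv : 0 ≤ v) :
    profilePolar f v ^ p = profileGauge f v ^ (-p) := by
  rw [profilePolar, Real.inv_rpow (hf.gauge_pos hv).le, ← Real.rpow_neg (hf.gauge_pos hv).le]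

theorem one_le_polarProduct_of_le_two (hf : IsProfile f) (hp : 1 < p) (hp2 : p ≤ 2) :
    1 ≤ polarProduct f p := by
  have hA := hf.powIntegral_pos hp
  have hle : (powIntegral f p * (p - 1))⁻¹ ≤ powIntegral (profilePolar f) p := by
    rw [← integral_Ioi_mul_add_one_rpow_neg hp hA]
    refine setIntegral_mono_on (integrableOn_Ioi_mul_add_one_rpow_neg hp hA)
      (hf.polar.integrableOn_rpow hp) measurableSet_Ioi fun v hv => ?_
    have hv0 := (mem_Ioi.1 hv).le
    rw [hf.polar_rpow p hv0]
    exact Real.rpow_le_rpow_of_nonpos (hf.gauge_pos hv0)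
      (hf.gauge_le_mul_powIntegral_add_one hp hp2 hv0) (by linarith)
  calc 1 ≤ powIntegral f p * (p - 1) * powIntegral (profilePolar f) p :=
        (inv_le_iff_one_le_mul₀' (mul_pos hA (sub_pos.2 hp))).1 hle
    _ = polarProduct f p := by rw [polarProduct]; ring

theorem exists_gauge_eq (hf : IsProfile f) (hp : 1 < p) (hp2 : p ≤ 2) (h : polarProduct f p = 1) :
    ∃ v > 0, profileGauge f v = powIntegral f p * v + 1 := by
  have hA := hf.powIntegral_pos hp
  by_contra! hne
  have hlt : (powIntegral f p * (p - 1))⁻¹ < powIntegral (profilePolar f) p := by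
    rw [← integral_Ioi_mul_add_one_rpow_neg hp hA]
    refine setIntegral_lt_setIntegral_of_lt measurableSet_Ioi (by simp)
      (integrableOn_Ioi_mul_add_one_rpow_neg hp hA) (hf.polar.integrableOn_rpow hp) fun v hv => ?_
    have hv0 : 0 < v := hv
    rw [hf.polar_rpow p hv0.le]
    exact Real.rpow_lt_rpow_of_neg (hf.gauge_pos hv0.le)
      ((hf.gauge_le_mul_powIntegral_add_one hp hp2 hv0.le).lt_of_ne (hne v hv0)) (by linarith)
  have hprod : 0 < powIntegral f p * (p - 1) := mul_pos hA (sub_pos.2 hp)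
  rw [inv_lt_iff_one_lt_mul₀' hprod] at hlt
  rw [polarProduct] at h
  linarith

theorem apply_eq_one_of_gauge_eq (hf : IsProfile f) (hp : 1 < p) (hp2 : p ≤ 2) (hv : 0 < v)
    (h : profileGauge f v = powIntegral f p * v + 1) (hx : 0 ≤ x) (hxA : x < powIntegral f p) :
    f x = 1 := by
  refine (hf.le_one hx).antisymm (not_lt.1 fun hfx => ?_)
  have hgauge : profileGauge f v ≤ max (1 + x * v) (f x + powIntegral f p * v) :=
    profileGauge_le fun u hu => by
      rcases le_total u x with hux | hxu
      · refine le_max_of_le_left ?_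
        calc (1 + u * v) * f u ≤ 1 + u * v :=
              mul_le_of_le_one_right (by positivity) (hf.le_one hu)
          _ ≤ 1 + x * v := by gcongr
      · refine le_max_of_le_right ?_
        calc (1 + u * v) * f u = f u + u * f u * v := by ring
          _ ≤ f x + powIntegral f p * v := by
            gcongr
            exacts [hf.antitoneOn hx hu hxu, hf.mul_apply_le_powIntegral hp hp2 hu]
  rcases le_max_iff.1 (h ▸ hgauge) with hle | hle
  · nlinarith
  · linarith

theorem powIntegral_eq_add_of_eq_one (hf : IsProfile f) (hp : 1 < p) (ha : 0 ≤ a)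
    (hone : ∀ x, 0 ≤ x → x < a → f x = 1) :
    powIntegral f p = a + ∫ x in Ioi a, f x ^ p := by
  rw [powIntegral, ← hf.integral_Ioc_add_integral_Ioi hp le_rfl ha, integral_Ioc_eq_integral_Ioo,
    setIntegral_congr_fun (g := fun _ => 1) measurableSet_Ioo
      fun x hx => by simp only [hone x hx.1.le hx.2, Real.one_rpow]]
  simp [ha]

theorem isStepAt_powIntegral (hf : IsProfile f) (hp : 1 < p) (hp2 : p ≤ 2)
    (h : polarProduct f p = 1) : IsStepAt (powIntegral f p) f := by
  obtain ⟨v, hv, hgauge⟩ := hf.exists_gauge_eq hp hp2 h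
  have hA := hf.powIntegral_nonneg p
  have hone := fun x => hf.apply_eq_one_of_gauge_eq (x := x) hp hp2 hv hgauge
  refine ⟨hone, fun x hx => (hf.nonneg (hA.trans hx.le)).eq_of_not_lt' fun hfx => ?_⟩
  have htail : ∫ y in Ioi (powIntegral f p), f y ^ p = 0 := by
    linarith [hf.powIntegral_eq_add_of_eq_one hp hA hone]
  have hpos : 0 < (x - powIntegral f p) * f x ^ p :=
    mul_pos (sub_pos.2 hx) (Real.rpow_pos_of_pos hfx p)
  linarith [hf.sub_mul_rpow_le_integral_Ioc hp hA hx.le,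
    hf.integral_Ioc_add_integral_Ioi hp hA hx.le,
    hf.integral_Ioi_rpow_nonneg p (hA.trans hx.le)]

theorem one_le_polarProduct_and_exists_isStepAt (hf : IsProfile f) (n : ℕ) :
    ∀ p : ℝ, 1 < p → p ≤ n + 2 →
      1 ≤ polarProduct f p ∧ (polarProduct f p = 1 → ∃ a > 0, IsStepAt a f) := by
  induction n with
  | zero =>
    intro p hp hp2
    have hp2 : p ≤ 2 := by simpa using hp2
    exact ⟨hf.one_le_polarProduct_of_le_two hp hp2, fun h =>
      ⟨_, hf.powIntegral_pos hp, hf.isStepAt_powIntegral hp hp2 h⟩⟩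
  | succ n ih =>
    intro p hp hpn
    rcases le_or_gt p 2 with hp2 | hp2
    · exact ih p hp (hp2.trans (by linarith [n.cast_nonneg (α := ℝ)]))
    push_cast at hpn
    have hrec := hf.one_add_mul_polarProduct_le (q := p - 1) (by linarith)
    rw [sub_add_cancel] at hrec
    obtain ⟨hle, heq⟩ := ih (p - 1) (by linarith) (by linarith)
    refine ⟨by nlinarith, fun h => heq (hle.antisymm' ?_)⟩
    rw [h] at hrec
    nlinarith

theorem one_le_polarProduct (hf : IsProfile f) (hp : 1 < p) : 1 ≤ polarProduct f p := by
  obtain ⟨n, hn⟩ := exists_nat_ge p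
  exact (hf.one_le_polarProduct_and_exists_isStepAt n p hp (by linarith)).1

theorem gauge_of_isStepAt (hf : IsProfile f) (ha : 0 < a) (h : IsStepAt a f) (hv : 0 ≤ v) :
    profileGauge f v = a * v + 1 := by
  refine le_antisymm (profileGauge_le fun u hu => ?_) ?_
  · rcases le_or_gt u a with hua | hau
    · calc (1 + u * v) * f u ≤ 1 + u * v :=
            mul_le_of_le_one_right (by positivity) (hf.le_one hu)
        _ ≤ a * v + 1 := by rw [add_comm]; gcongr
    · rw [h.2 u hau, mul_zero]
      positivity
  · have hlim : Tendsto (fun u : ℝ => 1 + u * v) (𝓝[<] a) (𝓝 (a * v + 1)) :=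
      (Continuous.tendsto' (by fun_prop) _ _ (by ring)).mono_left nhdsWithin_le_nhds
    refine le_of_tendsto hlim ?_
    filter_upwards [Ioo_mem_nhdsLT ha] with u hu
    simpa [h.1 u hu.1.le hu.2] using hf.le_gauge hu.1.le hv

theorem polarProduct_of_isStepAt (hf : IsProfile f) (hp : 1 < p) (ha : 0 < a)
    (h : IsStepAt a f) : polarProduct f p = 1 := by
  have htail : ∫ x in Ioi a, f x ^ p = 0 :=
    setIntegral_eq_zero_of_forall_eq_zero fun x hx => by
      rw [h.2 x hx, Real.zero_rpow (by linarith)]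
  have hpolar : powIntegral (profilePolar f) p = (a * (p - 1))⁻¹ := by
    rw [← integral_Ioi_mul_add_one_rpow_neg hp ha]
    refine setIntegral_congr_fun measurableSet_Ioi fun v hv => ?_
    have hv0 : 0 < v := hv
    simp only [hf.polar_rpow p hv0.le, hf.gauge_of_isStepAt ha h hv0.le]
  rw [polarProduct, hpolar, hf.powIntegral_eq_add_of_eq_one hp ha.le h.1, htail, add_zero]
  have hp1 : p - 1 ≠ 0 := (sub_pos.2 hp).ne'
  field_simp

theorem polarProduct_eq_one_iff (hf : IsProfile f) (hp : 1 < p) :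
    polarProduct f p = 1 ↔ ∃ a > 0, IsStepAt a f := by
  obtain ⟨n, hn⟩ := exists_nat_ge p
  exact ⟨(hf.one_le_polarProduct_and_exists_isStepAt n p hp (by linarith)).2,
    fun ⟨_, ha, h⟩ => hf.polarProduct_of_isStepAt hp ha h⟩

end IsProfile

/-- The profile `(g / g 0) ^ (-s)` of a function `g`, for which `s`-concavity of `g` becomes
convexity of the reciprocal. -/
noncomputable def sProfile (s : ℝ) (g : ℝ → ℝ≥0) (x : ℝ) : ℝ := ((g x : ℝ) / g 0) ^ (-s)

theorem one_lt_neg_one_div {s : ℝ} (hs : -1 < s) (hs0 : s < 0) : 1 < -(1 / s) := by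
  rw [← one_div_neg_eq_neg_one_div, lt_one_div one_pos (neg_pos.2 hs0)]
  linarith

section EvenFunctions

variable {s a x : ℝ} {c : ℝ≥0} {g : ℝ → ℝ≥0}

theorem apply_abs_of_even (heven : Function.Even g) (x : ℝ) : g |x| = g x := by
  rcases abs_choice x with h | h <;> rw [h]
  exact heven x

theorem exists_apply_pos_of_lintegral_pos (heven : Function.Even g)
    (hpos : 0 < ∫⁻ x, (g x : ℝ≥0∞)) : ∃ x > 0, 0 < g x := by
  by_contra! hg
  have hae : (fun x => (g x : ℝ≥0∞)) =ᵐ[volume] 0 := by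
    filter_upwards [Measure.ae_ne volume 0] with x hx
    simpa [apply_abs_of_even heven] using hg |x| (abs_pos.2 hx)
  rw [lintegral_congr_ae hae] at hpos
  simp at hpos

theorem exists_apply_lt_of_lintegral_lt_top (heven : Function.Even g)
    (hfin : ∫⁻ x, (g x : ℝ≥0∞) < ∞) (hc : 0 < c) : ∃ x > 0, g x < c := by
  by_contra! hg
  have hae : ∀ᵐ x : ℝ, (c : ℝ≥0∞) ≤ g x := by
    filter_upwards [Measure.ae_ne volume 0] with x hx
    simpa [apply_abs_of_even heven] using hg |x| (abs_pos.2 hx)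
  have hle := lintegral_mono_ae hae
  rw [lintegral_const, Real.volume_univ, ENNReal.mul_top (by simpa using hc.ne')] at hle
  exact hfin.not_ge hle

theorem sProfile_nonneg (s : ℝ) (g : ℝ → ℝ≥0) (x : ℝ) : 0 ≤ sProfile s g x := by
  unfold sProfile; positivity

theorem sProfile_eq_zero_iff (hs0 : s < 0) (h0 : 0 < g 0) : sProfile s g x = 0 ↔ g x = 0 := by
  rw [sProfile, Real.rpow_eq_zero (by positivity) (neg_ne_zero.2 hs0.ne), div_eq_zero_iff,
    or_iff_left (by exact_mod_cast h0.ne')]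
  norm_cast

theorem sProfile_eq_one_iff (hs0 : s < 0) (h0 : 0 < g 0) : sProfile s g x = 1 ↔ g x = g 0 := by
  rw [sProfile, ← Real.one_rpow (-s), Real.rpow_left_inj (by positivity) zero_le_one
    (neg_ne_zero.2 hs0.ne), div_eq_one_iff_eq (by exact_mod_cast h0.ne')]
  norm_cast

theorem sProfile_pos_iff (hs0 : s < 0) (h0 : 0 < g 0) : 0 < sProfile s g x ↔ 0 < g x := by
  rw [(sProfile_nonneg s g x).lt_iff_ne', Ne, sProfile_eq_zero_iff hs0 h0, pos_iff_ne_zero]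

theorem inv_sProfile (s : ℝ) (g : ℝ → ℝ≥0) (x : ℝ) :
    (sProfile s g x)⁻¹ = ((g 0 : ℝ) ^ s)⁻¹ * (g x : ℝ) ^ s := by
  rw [sProfile, Real.rpow_neg (by positivity), inv_inv, Real.div_rpow (by positivity)
    (by positivity), div_eq_inv_mul]

theorem sProfile_rpow (hs0 : s < 0) (g : ℝ → ℝ≥0) (x : ℝ) :
    sProfile s g x ^ (-(1 / s)) = g x / g 0 := by
  rw [sProfile, ← Real.rpow_mul (by positivity), neg_mul_neg, mul_one_div_cancel hs0.ne,
    Real.rpow_one]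

theorem isStepAt_sProfile_iff (hs0 : s < 0) (heven : Function.Even g) (h0 : 0 < g 0) (ha : 0 < a) :
    IsStepAt a (sProfile s g) ↔
      ∀ x, x ≠ a → x ≠ -a → g x = (Icc (-a) a).indicator (fun _ => g 0) x := by
  constructor
  · rintro ⟨hone, hzero⟩ x hxa hxa'
    rw [← apply_abs_of_even heven x]
    have hne : |x| ≠ a := fun h => (abs_eq ha.le).1 h |>.elim hxa hxa'
    rcases lt_or_gt_of_ne hne with h | h
    · rw [indicator_of_mem (mem_Icc.2 (abs_le.1 h.le))]
      exact (sProfile_eq_one_iff hs0 h0).1 (hone |x| (abs_nonneg x) h)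
    · rw [indicator_of_notMem fun hx => (abs_le.2 (mem_Icc.1 hx)).not_gt h]
      exact (sProfile_eq_zero_iff hs0 h0).1 (hzero |x| h)
  · refine fun h => ⟨fun x hx hxa => ?_, fun x hxa => ?_⟩
    · rw [sProfile_eq_one_iff hs0 h0, h x hxa.ne (by linarith),
        indicator_of_mem (mem_Icc.2 ⟨by linarith, hxa.le⟩)]
    · rw [sProfile_eq_zero_iff hs0 h0, h x hxa.ne' (by linarith),
        indicator_of_notMem fun hx => hx.2.not_gt hxa]

theorem exists_isStepAt_sProfile_iff (hs0 : s < 0) (heven : Function.Even g) (h0 : 0 < g 0) :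
    (∃ a > 0, IsStepAt a (sProfile s g)) ↔ ∃ (c : ℝ≥0) (a : ℝ), 0 < c ∧ 0 < a ∧
      ∀ x, x ≠ a → x ≠ -a → g x = (Icc (-a) a).indicator (fun _ => c) x := by
  constructor
  · rintro ⟨a, ha, h⟩
    exact ⟨g 0, a, h0, ha, (isStepAt_sProfile_iff hs0 heven h0 ha).1 h⟩
  · rintro ⟨c, a, -, ha, h⟩
    obtain rfl : g 0 = c := by
      rw [h 0 ha.ne (by linarith), indicator_of_mem (mem_Icc.2 (by constructor <;> linarith))]
    exact ⟨a, ha, (isStepAt_sProfile_iff hs0 heven h0 ha).2 h⟩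

theorem eq_indicator_of_upperSemicontinuous (husc : UpperSemicontinuous g) (ha : 0 < a)
    (hle : ∀ x, g x ≤ g 0)
    (hg : ∀ x, x ≠ a → x ≠ -a → g x = (Icc (-a) a).indicator (fun _ => c) x) :
    g = (Icc (-a) a).indicator fun _ => c := by
  have hin : ∀ x ∈ Ioo (-a) a, g x = c := fun x hx => by
    rw [hg x hx.2.ne hx.1.ne', indicator_of_mem (Ioo_subset_Icc_self hx)]
  have hsub : Icc (-a) a ⊆ g ⁻¹' Ici c := by
    rw [← closure_Ioo (by linarith)]
    exact closure_minimal (fun x hx => (hin x hx).ge) (husc.isClosed_preimage c)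
  have h0 : g 0 = c := hin 0 ⟨by linarith, ha⟩
  funext x
  by_cases hx : x ∈ Icc (-a) a
  · rw [indicator_of_mem hx]
    exact ((hle x).trans h0.le).antisymm (hsub hx)
  · refine hg x ?_ ?_ <;> rintro rfl <;> exact hx (by simp [ha.le])

theorem ofReal_mul_sProfile_rpow_div (hs0 : s < 0) (h0 : 0 < g 0) (hx : 0 < g x) (T : ℝ) :
    ENNReal.ofReal (T * sProfile s g x) ^ (1 / s) / g 0 = ENNReal.ofReal T ^ (1 / s) / g x := by
  have hfx := (sProfile_pos_iff hs0 h0).2 hx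
  have hpow : ENNReal.ofReal (sProfile s g x) ^ (1 / s) = g 0 / g x := by
    have hinv : sProfile s g x ^ (1 / s) = g 0 / g x := by
      rw [← neg_neg (1 / s), Real.rpow_neg hfx.le, sProfile_rpow hs0, inv_div]
    rw [ENNReal.ofReal_rpow_of_pos hfx, hinv, ENNReal.ofReal_div_of_pos (by exact_mod_cast hx),
      ENNReal.ofReal_coe_nnreal, ENNReal.ofReal_coe_nnreal]
  rw [ENNReal.ofReal_mul' hfx.le, ENNReal.mul_rpow_of_ne_top ENNReal.ofReal_ne_top
    ENNReal.ofReal_ne_top, hpow, ← mul_div_assoc, ENNReal.div_right_comm,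
    ENNReal.mul_div_cancel_right (by exact_mod_cast h0.ne') ENNReal.coe_ne_top]

theorem antitone_ofReal_rpow_div (hs0 : s < 0) (C : ℝ≥0∞) :
    Antitone fun m : ℝ => ENNReal.ofReal m ^ (1 / s) / C := by
  intro m m' hm
  have hexp : 0 ≤ -(1 / s) := neg_nonneg.2 (one_div_nonpos.2 hs0.le)
  refine ENNReal.div_le_div_right ?_ C
  rw [← neg_neg (1 / s), ENNReal.rpow_neg _ (-(1 / s)), ENNReal.rpow_neg _ (-(1 / s))]
  exact ENNReal.inv_le_inv.2 (ENNReal.rpow_le_rpow (ENNReal.ofReal_le_ofReal hm) hexp)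

theorem sPolar_eq_iInf (hs0 : s < 0) (heven : Function.Even g) (h0 : 0 < g 0) (y : ℝ) :
    sPolar s g y = ⨅ u : ℝ≥0,
      ENNReal.ofReal ((1 + u * (-s * |y|)) * sProfile s g u) ^ (1 / s) / (g 0 : ℝ≥0∞) := by
  simp only [sPolar, if_neg hs0.ne]
  refine le_antisymm (le_iInf fun u => ?_) (le_iInf₂ fun x hx => ?_)
  · rcases eq_zero_or_pos (g u) with hgu | hgu
    · rw [(sProfile_eq_zero_iff hs0 h0).2 hgu, mul_zero, ENNReal.ofReal_zero,
        ENNReal.zero_rpow_of_neg (one_div_neg.2 hs0), ENNReal.top_div_of_ne_top ENNReal.coe_ne_top]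
      exact le_top
    obtain ⟨x, hgx, hxy⟩ : ∃ x, g x = g u ∧ x * y = u * |y| := by
      rcases abs_choice y with h | h
      · exact ⟨u, rfl, by rw [h]⟩
      · exact ⟨-u, heven u, by rw [h]; ring⟩
    rw [ofReal_mul_sProfile_rpow_div hs0 h0 hgu]
    refine iInf₂_le_of_le x (hgx ▸ hgu) (le_of_eq ?_)
    rw [hgx, hxy]
    congr 3
    ring
  · refine iInf_le_of_le (Real.nnabs x) ?_
    rw [Real.coe_nnabs, ofReal_mul_sProfile_rpow_div hs0 h0 (by rwa [apply_abs_of_even heven]),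
      apply_abs_of_even heven]
    refine antitone_ofReal_rpow_div hs0 _ ?_
    nlinarith [le_abs_self (x * y), abs_mul x y]

theorem sPolar_eq (hs0 : s < 0) (heven : Function.Even g) (hf : IsProfile (sProfile s g))
    (h0 : 0 < g 0) (y : ℝ) :
    sPolar s g y =
      ENNReal.ofReal ((g 0 : ℝ)⁻¹ * profilePolar (sProfile s g) (-s * |y|) ^ (-(1 / s))) := by
  have hv : 0 ≤ -s * |y| := mul_nonneg (neg_nonneg.2 hs0.le) (abs_nonneg y)
  have hcont : Continuous fun m : ℝ => ENNReal.ofReal m ^ (1 / s) / (g 0 : ℝ≥0∞) :=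
    (ENNReal.continuous_div_const _ (by exact_mod_cast h0.ne')).comp
      (ENNReal.continuous_rpow_const.comp ENNReal.continuous_ofReal)
  have hgauge := hf.gauge_pos hv
  rw [sPolar_eq_iInf hs0 heven h0, ← Antitone.map_ciSup_of_continuousAt hcont.continuousAt
    (antitone_ofReal_rpow_div hs0 _) (hf.bddAbove_range_gauge hv), ← profileGauge,
    ENNReal.ofReal_rpow_of_pos hgauge, hf.polar_rpow _ hv, neg_neg,
    ENNReal.ofReal_mul (by positivity), ENNReal.ofReal_inv_of_pos (by exact_mod_cast h0),
    ENNReal.ofReal_coe_nnreal, ENNReal.div_eq_inv_mul]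

theorem lintegral_eq_powIntegral (hs0 : s < 0) (hp : 1 < -(1 / s)) (heven : Function.Even g)
    (hf : IsProfile (sProfile s g)) (h0 : 0 < g 0) :
    ∫⁻ x, (g x : ℝ≥0∞) =
      ENNReal.ofReal (2 * (g 0 * powIntegral (sProfile s g) (-(1 / s)))) := by
  have h := lintegral_ofReal_comp_mul_abs one_pos ((hf.integrableOn_rpow hp).const_mul (g 0 : ℝ))
    fun x _ => mul_nonneg (g 0).coe_nonneg (Real.rpow_nonneg (sProfile_nonneg s g x) _)
  rw [inv_one, one_mul, integral_const_mul, ← powIntegral] at h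
  rw [← h]
  refine lintegral_congr fun x => ?_
  rw [one_mul, sProfile_rpow hs0, apply_abs_of_even heven,
    mul_div_cancel₀ _ (by exact_mod_cast h0.ne'), ENNReal.ofReal_coe_nnreal]

theorem lintegral_sPolar_eq_powIntegral (hs0 : s < 0) (hp : 1 < -(1 / s))
    (heven : Function.Even g) (hf : IsProfile (sProfile s g)) (h0 : 0 < g 0) :
    ∫⁻ y, sPolar s g y = ENNReal.ofReal
      (2 * ((-s)⁻¹ * ((g 0 : ℝ)⁻¹ * powIntegral (profilePolar (sProfile s g)) (-(1 / s))))) := by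
  simp only [sPolar_eq hs0 heven hf h0]
  rw [lintegral_ofReal_comp_mul_abs (neg_pos.2 hs0)
    ((hf.polar.integrableOn_rpow hp).const_mul (g 0 : ℝ)⁻¹) fun v hv =>
      mul_nonneg (by positivity) (Real.rpow_nonneg (hf.polar.nonneg hv) _),
    integral_const_mul, powIntegral]

theorem lintegral_mul_lintegral_sPolar (hs : -1 < s) (hs0 : s < 0) (heven : Function.Even g)
    (hf : IsProfile (sProfile s g)) (h0 : 0 < g 0) :
    (∫⁻ x, (g x : ℝ≥0∞)) * ∫⁻ y, sPolar s g y =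
      ENNReal.ofReal (4 / (1 + s) * polarProduct (sProfile s g) (-(1 / s))) := by
  have hp := one_lt_neg_one_div hs hs0
  have hg0 : (g 0 : ℝ) ≠ 0 := by exact_mod_cast h0.ne'
  have hs1 : 1 + s ≠ 0 := by linarith
  have hs0' := hs0.ne
  have hA := hf.powIntegral_nonneg (-(1 / s))
  rw [lintegral_eq_powIntegral hs0 hp heven hf h0,
    lintegral_sPolar_eq_powIntegral hs0 hp heven hf h0, ← ENNReal.ofReal_mul (by positivity),
    polarProduct]
  congr 1
  field_simp
  ring

end EvenFunctions

namespace IsSConcave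

variable {s x : ℝ} {g : ℝ → ℝ≥0}

theorem convexOn_rpow (hconc : IsSConcave s g) (hs0 : s < 0) :
    ConvexOn ℝ {x | 0 < g x} fun x => (g x : ℝ) ^ s := by
  have hmean : ∀ {x y a b : ℝ}, 0 < g x → 0 < g y → 0 ≤ a → 0 ≤ b → a + b = 1 →
      0 < g (a * x + b * y) ∧
        (g (a * x + b * y) : ℝ) ^ s ≤ a * (g x : ℝ) ^ s + b * (g y : ℝ) ^ s := by
    intro x y a b hx hy ha hb hab
    obtain rfl : a = 1 - b := by linarith
    have hx' : (0 : ℝ) < g x := by exact_mod_cast hx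
    have hy' : (0 : ℝ) < g y := by exact_mod_cast hy
    have hM : 0 < (1 - b) * (g x : ℝ) ^ s + b * (g y : ℝ) ^ s :=
      (convex_Ioi (0 : ℝ)) (Real.rpow_pos_of_pos hx' s) (Real.rpow_pos_of_pos hy' s) ha hb hab
    have h := hconc x y b hb (by linarith) (mul_pos hx hy)
    rw [if_neg hs0.ne] at h
    have hMpow := Real.rpow_pos_of_pos hM (1 / s)
    refine ⟨by exact_mod_cast hMpow.trans_le h, ?_⟩
    calc _ ≤ _ := Real.rpow_le_rpow_of_nonpos hMpow h hs0.le
      _ = _ := by rw [one_div, Real.rpow_inv_rpow hM.le hs0.ne]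
  exact ⟨fun x hx y hy a b ha hb hab => (hmean hx hy ha hb hab).1,
    fun x hx y hy a b ha hb hab => (hmean hx hy ha hb hab).2⟩

theorem apply_le_apply_zero (hconc : IsSConcave s g) (hs0 : s < 0) (heven : Function.Even g)
    (x : ℝ) : g x ≤ g 0 := by
  rcases eq_zero_or_pos (g x) with hx | hx
  · exact hx ▸ zero_le
  have hx' : 0 < g (-x) := (heven x).symm ▸ hx
  have hconv := hconc.convexOn_rpow hs0
  have hmid : (1 / 2 : ℝ) • x + (1 / 2 : ℝ) • -x = 0 := by simp
  have hpos := hconv.1 hx hx' one_half_pos.le one_half_pos.le (add_halves 1)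
  have hle := hconv.2 hx hx' one_half_pos.le one_half_pos.le (add_halves 1)
  simp only [hmid, heven x, ← add_smul, add_halves, one_smul] at hpos hle
  exact_mod_cast (Real.rpow_le_rpow_iff_of_neg (by exact_mod_cast hpos) (by exact_mod_cast hx)
    hs0).1 hle

theorem isProfile (hconc : IsSConcave s g) (hs0 : s < 0) (heven : Function.Even g)
    (hpos : 0 < ∫⁻ x, (g x : ℝ≥0∞)) (hfin : ∫⁻ x, (g x : ℝ≥0∞) < ∞) (h0 : 0 < g 0) :
    IsProfile (sProfile s g) where
  nonneg _ := sProfile_nonneg s g _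
  map_zero := (sProfile_eq_one_iff hs0 h0).2 rfl
  le_one {x} _ := Real.rpow_le_one (by positivity)
    (div_le_one_of_le₀ (by exact_mod_cast hconc.apply_le_apply_zero hs0 heven x) (by positivity))
    (by linarith)
  convexOn_inv := by
    have hconv := hconc.convexOn_rpow hs0
    simp only [inv_sProfile, sProfile_pos_iff hs0 h0]
    exact (hconv.smul (by positivity)).subset (fun x hx => hx.2) ((convex_Ici 0).inter hconv.1)
  exists_pos := by
    simpa only [sProfile_pos_iff hs0 h0] using exists_apply_pos_of_lintegral_pos heven hpos
  exists_lt_one := by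
    obtain ⟨x, hx, hlt⟩ := exists_apply_lt_of_lintegral_lt_top heven hfin h0
    exact ⟨x, hx, Real.rpow_lt_one (by positivity)
      ((div_lt_one (by exact_mod_cast h0)).2 (by exact_mod_cast hlt)) (by linarith)⟩

end IsSConcave

theorem theorem1p6 (s : ℝ) (hs : -1 < s) (hs0 : s < 0) (g : ℝ → ℝ≥0)
    (heven : Function.Even g) (hconc : IsSConcave s g)
    (hpos : 0 < ∫⁻ x, (g x : ℝ≥0∞)) (hfin : ∫⁻ x, (g x : ℝ≥0∞) < ∞) :
    ENNReal.ofReal (4 / (1 + s)) ≤ (∫⁻ x, (g x : ℝ≥0∞)) * ∫⁻ y, sPolar s g y ∧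
    ((∫⁻ x, (g x : ℝ≥0∞)) * ∫⁻ y, sPolar s g y = ENNReal.ofReal (4 / (1 + s)) ↔
      ∃ (c : ℝ≥0) (a : ℝ), 0 < c ∧ 0 < a ∧
        ∀ x : ℝ, x ≠ a → x ≠ -a → g x = (Set.Icc (-a) a).indicator (fun _ => c) x) ∧
    (UpperSemicontinuous g →
      ((∫⁻ x, (g x : ℝ≥0∞)) * ∫⁻ y, sPolar s g y = ENNReal.ofReal (4 / (1 + s)) ↔
        ∃ (c : ℝ≥0) (a : ℝ), 0 < c ∧ 0 < a ∧
          g = (Set.Icc (-a) a).indicator (fun _ => c))) := by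
  have hle := hconc.apply_le_apply_zero hs0 heven
  obtain ⟨x, -, hx⟩ := exists_apply_pos_of_lintegral_pos heven hpos
  have h0 : 0 < g 0 := hx.trans_le (hle x)
  have hf := hconc.isProfile hs0 heven hpos hfin h0
  have hp := one_lt_neg_one_div hs hs0
  have h4 : 0 < 4 / (1 + s) := div_pos four_pos (by linarith)
  have hone := hf.one_le_polarProduct hp
  have hiff := (ENNReal.ofReal_eq_ofReal_iff (by positivity) h4.le).trans <|
    (mul_eq_left₀ h4.ne').trans <|
    (hf.polarProduct_eq_one_iff hp).trans (exists_isStepAt_sProfile_iff hs0 heven h0)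
  rw [lintegral_mul_lintegral_sPolar hs hs0 heven hf h0]
  refine ⟨ENNReal.ofReal_le_ofReal (le_mul_of_one_le_right h4.le hone), hiff, fun husc =>
    hiff.trans <| exists₂_congr fun c a => and_congr_right fun _ => and_congr_right fun ha =>
      ⟨eq_indicator_of_upperSemicontinuous husc ha hle, fun hg x _ _ => congrFun hg x⟩⟩
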